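/- A \emph{plane branch} (irreducible complex plane curve singularity) $C$ is given by a primitive parametrization $t\mapsto(x(t),y(t))$ with $x,y\in\mathbb{C}[[t]]$, $x(0)=y(0)=0$; primitive means that there are no $s,\varphi,\psi\in\mathbb{C}[[t]]$ with $\operatorname{ord} s\ge 2$, $x=\varphi(s)$ and $y=\psi(s)$. (Every irreducible complex analytic plane curve germ is of this kind.) Its semigroup is $$\Gamma=\{\operatorname{ord}_t g(x(t),y(t)) : g\in\mathbb{C}[[X,Y]],\ g(x(t),y(t))\neq 0\}\subset\mathbb{Z}_{\ge 0}.$$ A branch $C_1=(x_1,y_1)$ is the blow-up of a branch $C_2=(x_2,y_2)$ if it is the strict transform of $C_2$ under the blow-up of the origin, written in a standard chart centred at the point of the strict transform on the exceptional divisor: for some $c\in\mathbb{C}$, either $(x_2,y_2)=(x_1,\;x_1(y_1+c))$ or $(x_2,y_2)=((x_1+c)y_1,\;y_1)$. Let $C_1$ be the blow-up of $C_2$, let $\Gamma_1,\Gamma_2$ be the semigroups of $C_1,C_2$, and let $H_i(k)=\#\{s\in\Gamma_i : s<k\}$ be their counting functions. Let $m=\min\{s\in\Gamma_2 : s>0\}$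 be the multiplicity of $\Gamma_2$, and let $H_{[m]}(k)=\#\{s\in\langle m,m+1\rangle : s<k\}$, where $\langle m,m+1\rangle\subset\mathbb{Z}_{\ge 0}$ is the additive monoid generated by $m$ and $m+1$. Then for all integers $l\ge 0$, $$H_2(l)=\min_{0\le j\le l}\bigl\{H_1(l-j)+H_{[m]}(j)\bigr\}.$$ -/

import Mathlib

open scoped PowerSeries

noncomputable section

/-- A plane branch: an irreducible plane curve germ at the origin over `ℂ`, given by a
parametrization `t ↦ (x(t), y(t))` centred at the origin.  The parametrization is primitive
(generically injective): `x` and `y` are not both power series in one series of order at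
least two. -/
structure PlaneBranch where
  x : ℂ⟦X⟧
  y : ℂ⟦X⟧
  x_zero : x.constantCoeff = 0
  y_zero : y.constantCoeff = 0
  primitive : ¬ ∃ s φ ψ : ℂ⟦X⟧, 2 ≤ s.order ∧ x = φ.subst s ∧ y = ψ.subst s

namespace PlaneBranch

/-- The pull-back `g(x(t), y(t))` of a function germ `g` of the plane to the branch. -/
def pullback (C : PlaneBranch) (g : MvPowerSeries (Fin 2) ℂ) : ℂ⟦X⟧ :=
  MvPowerSeries.subst (τ := Unit) (S := ℂ) ![C.x, C.y] g

theorem hasSubst (C : PlaneBranch) :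
    MvPowerSeries.HasSubst (τ := Unit) (S := ℂ) ![C.x, C.y] := by
  apply MvPowerSeries.hasSubst_of_constantCoeff_zero
  intro i
  fin_cases i
  · exact C.x_zero
  · exact C.y_zero

theorem pullback_one (C : PlaneBranch) : C.pullback 1 = 1 := by
  rw [pullback, ← MvPowerSeries.coe_substAlgHom (R := ℂ) C.hasSubst]
  exact map_one _

theorem pullback_mul (C : PlaneBranch) (g h : MvPowerSeries (Fin 2) ℂ) :
    C.pullback (g * h) = C.pullback g * C.pullback h :=
  MvPowerSeries.subst_mul C.hasSubst g h

/-- The semigroup of the branch: all (finite) orders of vanishing `ord_t g(x(t), y(t))`, that is,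
all finite intersection multiplicities of the branch with germs `g = 0`. -/
def semigroup (C : PlaneBranch) : AddSubmonoid ℕ where
  carrier := {n | ∃ g : MvPowerSeries (Fin 2) ℂ, (C.pullback g).order = n}
  zero_mem' := ⟨1, by rw [pullback_one, PowerSeries.order_one]; rfl⟩
  add_mem' := by
    rintro a b ⟨g, hg⟩ ⟨h, hh⟩
    exact ⟨g * h, by rw [pullback_mul, PowerSeries.order_mul, hg, hh]; rfl⟩

/-- `C₁.IsBlowupOf C₂`: the branch `C₁` is the strict transform of `C₂` under the blow-up
of the origin.  The blow-up is covered by the two charts `(u, v) ↦ (u, u * v)` and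
`(u, v) ↦ (u * v, v)`; the branch `C₁` is written in the coordinates of such a chart, translated
along the exceptional divisor so that the point of the strict transform becomes the origin. -/
def IsBlowupOf (C₁ C₂ : PlaneBranch) : Prop :=
  (∃ c : ℂ, C₂.x = C₁.x ∧ C₂.y = C₁.x * (C₁.y + PowerSeries.C c)) ∨
  (∃ c : ℂ, C₂.x = (C₁.x + PowerSeries.C c) * C₁.y ∧ C₂.y = C₁.y)

end PlaneBranch

/-- The multiplicity of a semigroup of natural numbers: its smallest positive element. -/
def semigroupMultiplicity (Γ : AddSubmonoid ℕ) : ℕ :=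
  sInf {s : ℕ | s ∈ Γ ∧ 0 < s}

/-- The counting function `k ↦ #{s ∈ Γ : s < k}`. -/
def countingFunction (Γ : AddSubmonoid ℕ) (k : ℕ) : ℕ :=
  Set.ncard {s : ℕ | s ∈ Γ ∧ s < k}

end

/-!
Let `x`, of order `m`, and `y` be the coordinates of the blow-up `C₁` in a chart, so that the
coordinates of `C₂` are `x` and `x * (y + c)`; the other chart reduces to this one by exchanging
the coordinates. Truncating power series shows that the semigroup of a branch is the set of orders
of the elements of the polynomial algebra `ℂ[x, y] ⊆ ℂ⟦t⟧` (`PlaneBranch.mem_semigroup_iff`).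

Reducing `y * f i` modulo the `ℂ[x]`-span of `f 0, …, f i` to an element `f (i + 1)` of the largest
possible order produces, from `f 0 = 1`, polynomials `f i` which are monic of degree `i` in `y` and
whose orders `a i` are increasing and distinct modulo `m` (`IsOrderChain`). There are at most `m` of
them, so at some stage `y * f (n - 1)` lies in the `t`-adic closure of the span; the closure is then
stable under multiplication by `x` and `y`, and the orders of elements of `ℂ[x, y]` are exactly the
numbers `a i + k * m` with `i < n` (`IsOrderChain.exists_order_eq_iff`). If `f i` is monic of degree
`i` in `y`, then `x ^ i * f i` is monic of degree `i` in `x * (y + c)`, so the series `x ^ i * f i`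
form such a chain for `C₂` (`IsOrderChain.blowup`), with orders `a i + i * m`.

That `n = m` is where primitivity enters. If the greatest common divisor `e` of the semigroup were
at least two, some quotient `s` of two elements of `ℂ[x, y]` would be a power series of order `e`, and repeatedly subtracting the constant term and dividing by `s` would exhibit `x` and `y`
as power series in `s` (`exists_forall_eq_subst`). Hence the semigroup meets all residue classes
modulo `m`.

The three semigroups are therefore unions over `i < m` of progressions with difference `m`, starting
at `a i`, at `a i + i * m`, and, for `⟨m, m + 1⟩`, at `i + i * m`. Their counting functions are sums
of positive parts of quotients rounded up, and the formula becomes an inequality between such sums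
(`sum_ceilQuot_le`) which is attained because `a` is increasing (`exists_sum_ceilQuot_ge`).
-/

namespace PowerSeries

variable {K : Type*} [Field K]

/-! ### Orders of power series -/

theorem order_eq_of_X_pow_dvd_sub {g v : K⟦X⟧} {n N : ℕ} (hg : g.order = n) (hN : n < N)
    (h : X ^ N ∣ g - v) : v.order = n := by
  rw [order_eq_nat] at hg ⊢
  rw [X_pow_dvd_iff] at h
  have key : ∀ i < N, coeff i g = coeff i v := fun i hi => by
    have := h i hi
    rwa [map_sub, sub_eq_zero] at this
  exact ⟨by rw [← key n hN]; exact hg.1, fun i hi => by rw [← key i (hi.trans hN)]; exact hg.2 i hi⟩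

theorem eq_zero_of_forall_X_pow_dvd {g : K⟦X⟧} (h : ∀ N : ℕ, X ^ N ∣ g) : g = 0 := by
  ext n
  exact X_pow_dvd_iff.1 (h (n + 1)) n n.lt_succ_self

theorem X_pow_dvd_iff_le_order {g : K⟦X⟧} {n : ℕ} : X ^ n ∣ g ↔ (n : ℕ∞) ≤ g.order := by
  rw [X_pow_dvd_iff]
  exact ⟨nat_le_order g n, fun h i hi => coeff_of_lt_order i ((Nat.cast_lt.2 hi).trans_le h)⟩

theorem exists_order_eq {g : K⟦X⟧} (hg : g ≠ 0) : ∃ n : ℕ, g.order = n :=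
  ⟨_, (coe_toNat_order hg).symm⟩

theorem ne_zero_of_order_eq {g : K⟦X⟧} {n : ℕ} (h : g.order = n) : g ≠ 0 := by
  rintro rfl
  simp at h

theorem order_smul_of_ne_zero {c : K} (hc : c ≠ 0) (g : K⟦X⟧) : (c • g).order = g.order := by
  apply le_antisymm
  · conv_rhs => rw [← inv_smul_smul₀ hc g]
    exact le_order_smul
  · exact le_order_smul

/-- Two series of the same order have proportional leading terms, so subtracting a multiple of one
from the other raises the order. -/
theorem exists_X_pow_dvd_sub_smul {g v : K⟦X⟧} {n : ℕ} (hg : X ^ n ∣ g) (hv : v.order = n) :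
    ∃ c : K, X ^ (n + 1) ∣ g - c • v := by
  rw [X_pow_dvd_iff] at hg
  rw [order_eq_nat] at hv
  refine ⟨coeff n g / coeff n v, X_pow_dvd_iff.2 fun i hi => ?_⟩
  rcases Nat.lt_succ_iff_lt_or_eq.1 hi with hi | rfl
  · simp [hg i hi, hv.2 i hi]
  · simp [hv.1]

/-- A nonzero linear combination of series with pairwise distinct orders has the order of one of
them: the leading terms cannot cancel. -/
theorem exists_order_sum_eq {F : Finset K⟦X⟧} (hinj : Set.InjOn order (F : Set K⟦X⟧))
    (c : K⟦X⟧ → K) (h0 : ∑ v ∈ F, c v • v ≠ 0) :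
    ∃ v ∈ F, (∑ v ∈ F, c v • v).order = v.order := by
  classical
  induction F using Finset.induction_on with
  | empty => simp at h0
  | insert u F hu ih =>
    have ih := ih (hinj.mono (by simp))
    rw [Finset.sum_insert hu] at h0 ⊢
    by_cases hc : c u = 0
    · rw [hc, zero_smul, zero_add] at h0 ⊢
      obtain ⟨w, hw, hwF⟩ := ih h0
      exact ⟨w, Finset.mem_insert_of_mem hw, hwF⟩
    by_cases hF : ∑ v ∈ F, c v • v = 0
    · exact ⟨u, Finset.mem_insert_self u F, by rw [hF, add_zero, order_smul_of_ne_zero hc]⟩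
    obtain ⟨w, hw, hwF⟩ := ih hF
    have hne : u.order ≠ w.order := fun h => hu <| by
      rwa [hinj (Finset.mem_insert_self u F) (Finset.mem_insert_of_mem hw) h]
    rw [order_add_of_order_ne _ _ (by rwa [order_smul_of_ne_zero hc, hwF]),
      order_smul_of_ne_zero hc, hwF]
    rcases min_choice u.order w.order with h | h
    · exact ⟨u, Finset.mem_insert_self u F, h⟩
    · exact ⟨w, Finset.mem_insert_of_mem hw, h⟩

theorem exists_order_eq_of_mem_span {s : Set K⟦X⟧} (hinj : Set.InjOn order s)
    {g : K⟦X⟧} (hg : g ∈ Submodule.span K s) (h0 : g ≠ 0) : ∃ v ∈ s, g.order = v.order := by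
  obtain ⟨c, F, hFs, -, rfl⟩ := Submodule.mem_span_iff_exists_finset_subset.1 hg
  obtain ⟨v, hv, hvF⟩ := exists_order_sum_eq (hinj.mono hFs) c h0
  exact ⟨v, hFs hv, hvF⟩

/-! ### The `t`-adic closure of a space of series -/

/-- The closure of a space of power series in the `X`-adic topology: the series which are
approximated by elements of the space to every order. -/
def adicClosure (V : Submodule K K⟦X⟧) : Submodule K K⟦X⟧ where
  carrier := {g | ∀ N : ℕ, ∃ v ∈ V, X ^ N ∣ g - v}
  zero_mem' N := ⟨0, V.zero_mem, by simp⟩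
  add_mem' {g h} hg hh N := by
    obtain ⟨v, hv, hgv⟩ := hg N
    obtain ⟨w, hw, hhw⟩ := hh N
    exact ⟨v + w, V.add_mem hv hw, by simpa [add_sub_add_comm] using dvd_add hgv hhw⟩
  smul_mem' c g hg N := by
    obtain ⟨v, hv, hgv⟩ := hg N
    refine ⟨c • v, V.smul_mem c hv, ?_⟩
    rw [← smul_sub, smul_eq_C_mul]
    exact hgv.mul_left _

theorem le_adicClosure (V : Submodule K K⟦X⟧) : V ≤ adicClosure V :=
  fun g hg _ => ⟨g, hg, by simp⟩

theorem exists_order_eq_of_mem_adicClosure {V : Submodule K K⟦X⟧} {g : K⟦X⟧}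
    (hg : g ∈ adicClosure V) (h0 : g ≠ 0) : ∃ v ∈ V, v ≠ 0 ∧ v.order = g.order := by
  obtain ⟨n, hn⟩ := exists_order_eq h0
  obtain ⟨v, hv, hgv⟩ := hg (n + 1)
  have := order_eq_of_X_pow_dvd_sub hn n.lt_succ_self hgv
  exact ⟨v, hv, ne_zero_of_order_eq this, this.trans hn.symm⟩

/-- Multiplication by a series is continuous. -/
theorem mul_mem_adicClosure {V W : Submodule K K⟦X⟧} {u g : K⟦X⟧}
    (h : ∀ v ∈ V, u * v ∈ adicClosure W) (hg : g ∈ adicClosure V) : u * g ∈ adicClosure W := by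
  intro N
  obtain ⟨v, hv, hgv⟩ := hg N
  obtain ⟨w, hw, hvw⟩ := h v hv N
  refine ⟨w, hw, ?_⟩
  have : u * g - w = u * (g - v) + (u * v - w) := by ring
  rw [this]
  exact dvd_add (hgv.mul_left u) hvw

theorem adjoin_le_of_mul_mem {x y : K⟦X⟧} {W : Submodule K K⟦X⟧} (h1 : 1 ∈ W)
    (hx : ∀ w ∈ W, x * w ∈ W) (hy : ∀ w ∈ W, y * w ∈ W) {g : K⟦X⟧}
    (hg : g ∈ Algebra.adjoin K {x, y}) : g ∈ W := by
  have key : ∀ w ∈ W, g * w ∈ W := by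
    induction hg using Algebra.adjoin_induction with
    | mem u hu =>
      rcases hu with rfl | rfl
      exacts [hx, hy]
    | algebraMap r => exact fun w hw => by rw [← Algebra.smul_def]; exact W.smul_mem r hw
    | add u v _ _ hu hv => exact fun w hw => by rw [add_mul]; exact W.add_mem (hu w hw) (hv w hw)
    | mul u v _ _ hu hv => exact fun w hw => by rw [mul_assoc]; exact hu _ (hv w hw)
  simpa using key 1 h1

/-! ### Order chains -/

/-- The `K[x]`-span of `f 0, …, f (n - 1)`. -/
def polySpan (x : K⟦X⟧) (f : ℕ → K⟦X⟧) (n : ℕ) : Submodule K K⟦X⟧ :=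
  Submodule.span K {g | ∃ j < n, ∃ k : ℕ, g = x ^ k * f j}

theorem pow_mul_mem_polySpan (x : K⟦X⟧) (f : ℕ → K⟦X⟧) {n j : ℕ} (hj : j < n) (k : ℕ) :
    x ^ k * f j ∈ polySpan x f n :=
  Submodule.subset_span ⟨j, hj, k, rfl⟩

theorem mem_polySpan (x : K⟦X⟧) (f : ℕ → K⟦X⟧) {n j : ℕ} (hj : j < n) :
    f j ∈ polySpan x f n := by
  simpa using pow_mul_mem_polySpan x f hj 0

theorem polySpan_mono (x : K⟦X⟧) (f : ℕ → K⟦X⟧) {n n' : ℕ} (h : n ≤ n') :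
    polySpan x f n ≤ polySpan x f n' :=
  Submodule.span_mono fun _ ⟨j, hj, k, hk⟩ => ⟨j, hj.trans_le h, k, hk⟩

/-- To multiply the `K[x]`-span by `u` into a subspace, it suffices to treat the generators. -/
theorem mul_mem_of_mem_polySpan {x u : K⟦X⟧} {f : ℕ → K⟦X⟧} {n : ℕ} {W : Submodule K K⟦X⟧}
    (h : ∀ j < n, ∀ k : ℕ, u * (x ^ k * f j) ∈ W) {g : K⟦X⟧} (hg : g ∈ polySpan x f n) :
    u * g ∈ W := by
  have : polySpan x f n ≤ W.comap (LinearMap.mulLeft K u) :=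
    Submodule.span_le.2 fun _ ⟨j, hj, k, hk⟩ => by
      subst hk
      exact h j hj k
  exact this hg

theorem pow_mul_mem_polySpan_of_mem {x : K⟦X⟧} {f : ℕ → K⟦X⟧} {n : ℕ} {g : K⟦X⟧}
    (hg : g ∈ polySpan x f n) (l : ℕ) : x ^ l * g ∈ polySpan x f n :=
  mul_mem_of_mem_polySpan (fun j hj k => by
    rw [← mul_assoc, ← pow_add]; exact pow_mul_mem_polySpan x f hj _) hg

theorem pow_mul_mem_adicClosure_polySpan {x : K⟦X⟧} {f : ℕ → K⟦X⟧} {n : ℕ} {g : K⟦X⟧}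
    (hg : g ∈ adicClosure (polySpan x f n)) (l : ℕ) :
    x ^ l * g ∈ adicClosure (polySpan x f n) :=
  mul_mem_adicClosure (fun _ hv => le_adicClosure _ (pow_mul_mem_polySpan_of_mem hv l)) hg

/-- A sequence `f 0 = 1, f 1, …, f (n - 1)` in which `f i` is a monic polynomial of degree `i` in
`y` over `K[x]`, has order `a i`, and the `a i` are distinct modulo `m`, the order of `x`.
Monicity is recorded recursively, as `f (i + 1) ∈ y * f i + ∑_{j ≤ i} K[x] * f j`. -/
structure IsOrderChain (x y : K⟦X⟧) (m n : ℕ) (a : ℕ → ℕ) (f : ℕ → K⟦X⟧) : Prop where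
  order_x : x.order = m
  order_pos : 0 < m
  pos : 0 < n
  f_zero : f 0 = 1
  order_f : ∀ i < n, (f i).order = a i
  residue : ∀ i < n, ∀ j < n, a i % m = a j % m → i = j
  step : ∀ i, i + 1 < n → y * f i - f (i + 1) ∈ polySpan x f (i + 1)

/-- An order chain is complete if, up to `X`-adic closure, its `K[x]`-span is stable under
multiplication by `y`; only the product with the last element needs to be controlled. -/
def IsCompleteChain (x y : K⟦X⟧) (n : ℕ) (f : ℕ → K⟦X⟧) : Prop :=
  y * f (n - 1) ∈ adicClosure (polySpan x f n)

namespace IsOrderChain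

variable {x y : K⟦X⟧} {m n : ℕ} {a : ℕ → ℕ} {f : ℕ → K⟦X⟧}

theorem order_pow_mul (h : IsOrderChain x y m n a f) {j : ℕ} (hj : j < n) (k : ℕ) :
    (x ^ k * f j).order = (a j + k * m : ℕ) := by
  rw [order_mul, order_pow, h.order_x, h.order_f j hj, add_comm]
  simp

theorem order_of_mem_adicClosure (h : IsOrderChain x y m n a f) {g : K⟦X⟧}
    (hg : g ∈ adicClosure (polySpan x f n)) (h0 : g ≠ 0) :
    ∃ i < n, ∃ k : ℕ, g.order = (a i + k * m : ℕ) := by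
  obtain ⟨v, hv, hv0, hvg⟩ := exists_order_eq_of_mem_adicClosure hg h0
  have hinj : Set.InjOn order {g : K⟦X⟧ | ∃ j < n, ∃ k : ℕ, g = x ^ k * f j} := by
    rintro _ ⟨i, hi, k, rfl⟩ _ ⟨j, hj, l, rfl⟩ hij
    rw [h.order_pow_mul hi, h.order_pow_mul hj, Nat.cast_inj] at hij
    have hmod : i = j := h.residue i hi j hj (by
      rw [← Nat.add_mul_mod_self_right (a i) k m, hij, Nat.add_mul_mod_self_right])
    subst hmod
    have : k = l := Nat.eq_of_mul_eq_mul_right h.order_pos (by omega)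
    rw [this]
  obtain ⟨w, ⟨j, hj, k, rfl⟩, hw⟩ := exists_order_eq_of_mem_span hinj hv hv0
  exact ⟨j, hj, k, by rw [← hvg, hw, h.order_pow_mul hj]⟩

theorem mem_adjoin (h : IsOrderChain x y m n a f) {i : ℕ} (hi : i < n) :
    f i ∈ Algebra.adjoin K {x, y} := by
  have hx : x ∈ Algebra.adjoin K {x, y} := Algebra.subset_adjoin (by simp)
  have hy : y ∈ Algebra.adjoin K {x, y} := Algebra.subset_adjoin (by simp)
  induction i using Nat.strong_induction_on with
  | _ i ih =>
    rcases i with _ | i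
    · rw [h.f_zero]
      exact one_mem _
    · have hle : polySpan x f (i + 1) ≤ Subalgebra.toSubmodule (Algebra.adjoin K {x, y}) :=
        Submodule.span_le.2 fun _ ⟨j, hj, k, hk⟩ => by
          subst hk
          exact Subalgebra.mul_mem _ (pow_mem hx k) (ih j hj (hj.trans hi))
      have := sub_mem (mul_mem hy (ih i i.lt_succ_self (by omega))) (hle (h.step i hi))
      rwa [sub_sub_cancel] at this

theorem adjoin_le_adicClosure (h : IsOrderChain x y m n a f) (hc : IsCompleteChain x y n f)
    {g : K⟦X⟧} (hg : g ∈ Algebra.adjoin K {x, y}) : g ∈ adicClosure (polySpan x f n) := by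
  refine adjoin_le_of_mul_mem ?_ (fun w hw => ?_) (fun w hw => ?_) hg
  · rw [← h.f_zero]
    exact le_adicClosure _ (mem_polySpan x f h.pos)
  · simpa using pow_mul_mem_adicClosure_polySpan hw 1
  · refine mul_mem_adicClosure (fun v hv => mul_mem_of_mem_polySpan (fun j hj k => ?_) hv) hw
    rw [mul_left_comm]
    apply pow_mul_mem_adicClosure_polySpan
    rcases Nat.lt_or_ge (j + 1) n with hj' | hj'
    · rw [← sub_add_cancel (y * f j) (f (j + 1))]
      exact le_adicClosure _ (add_mem (polySpan_mono x f hj (h.step j hj')) (mem_polySpan x f hj'))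
    · obtain rfl : j = n - 1 := by omega
      exact hc

/-- The orders of the elements of `K[x, y]` are read off from a complete order chain. -/
theorem exists_order_eq_iff (h : IsOrderChain x y m n a f) (hc : IsCompleteChain x y n f) (b : ℕ) :
    (∃ g ∈ Algebra.adjoin K {x, y}, g.order = b) ↔ ∃ i < n, ∃ k : ℕ, b = a i + k * m := by
  constructor
  · rintro ⟨g, hg, hb⟩
    obtain ⟨i, hi, k, hk⟩ :=
      h.order_of_mem_adicClosure (h.adjoin_le_adicClosure hc hg) (ne_zero_of_order_eq hb)
    exact ⟨i, hi, k, by rw [hb] at hk; exact_mod_cast hk⟩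
  · rintro ⟨i, hi, k, rfl⟩
    exact ⟨x ^ k * f i, mul_mem (pow_mem (Algebra.subset_adjoin (by simp)) k) (h.mem_adjoin hi),
      h.order_pow_mul hi k⟩

theorem length_le (h : IsOrderChain x y m n a f) : n ≤ m := by
  have := Finset.card_le_card_of_injOn (s := Finset.range n) (t := Finset.range m)
    (fun i => a i % m) (fun i _ => by simpa using Nat.mod_lt _ h.order_pos)
    (fun i hi j hj => h.residue i (by simpa using hi) j (by simpa using hj))
  simpa using this

/-! ### Order chains under blowing up -/

theorem pow_mul_mem_polySpan_blowup {l : ℕ} {g : K⟦X⟧} (hg : g ∈ polySpan x f n)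
    (hl : n ≤ l + 1) : x ^ l * g ∈ polySpan x (fun i => x ^ i * f i) n := by
  refine mul_mem_of_mem_polySpan (fun j hj k => ?_) hg
  have : x ^ l * (x ^ k * f j) = x ^ (l - j + k) * (x ^ j * f j) := by
    obtain ⟨d, rfl⟩ := Nat.exists_eq_add_of_le (show j ≤ l by omega)
    rw [Nat.add_sub_cancel_left]
    ring
  rw [this]
  exact pow_mul_mem_polySpan x (fun i => x ^ i * f i) hj _

/-- If `f i` is monic of degree `i` in `y`, then `x ^ i * f i` is monic of degree `i` in
`x * (y + c)`. -/
theorem blowup (h : IsOrderChain x y m n a f) (c : K) :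
    IsOrderChain x (x * (y + C c)) m n (fun i => a i + i * m) (fun i => x ^ i * f i) where
  order_x := h.order_x
  order_pos := h.order_pos
  pos := h.pos
  f_zero := by simp [h.f_zero]
  order_f i hi := h.order_pow_mul hi i
  residue i hi j hj hij := h.residue i hi j hj (by simpa using hij)
  step i hi := by
    have h1 := pow_mul_mem_polySpan_blowup (h.step i hi) (l := i + 1) (by omega)
    have h2 := pow_mul_mem_polySpan x (fun i => x ^ i * f i) i.lt_succ_self 1
    have : x * (y + C c) * (x ^ i * f i) - x ^ (i + 1) * f (i + 1) =
        x ^ (i + 1) * (y * f i - f (i + 1)) + c • (x ^ 1 * (x ^ i * f i)) := by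
      rw [smul_eq_C_mul]
      ring
    simp only [this]
    exact add_mem h1 (Submodule.smul_mem _ _ h2)

end IsOrderChain

theorem IsCompleteChain.blowup {x y : K⟦X⟧} {n : ℕ} {f : ℕ → K⟦X⟧} (hn : 0 < n)
    (h : IsCompleteChain x y n f) (c : K) :
    IsCompleteChain x (x * (y + C c)) n (fun i => x ^ i * f i) := by
  obtain ⟨n, rfl⟩ : ∃ k, n = k + 1 := ⟨n - 1, by omega⟩
  have h1 : x ^ (n + 1) * (y * f n) ∈ adicClosure (polySpan x (fun i => x ^ i * f i) (n + 1)) :=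
    mul_mem_adicClosure (fun v hv => le_adicClosure _
      (IsOrderChain.pow_mul_mem_polySpan_blowup hv (by omega))) h
  have h2 := le_adicClosure _ (pow_mul_mem_polySpan x (fun i => x ^ i * f i) n.lt_succ_self 1)
  have : x * (y + C c) * (x ^ n * f n) =
      x ^ (n + 1) * (y * f n) + c • (x ^ 1 * (x ^ n * f n)) := by
    rw [smul_eq_C_mul]
    ring
  simp only [IsCompleteChain, Nat.add_sub_cancel, this]
  exact add_mem h1 (Submodule.smul_mem _ _ h2)

/-! ### Existence of complete order chains -/

/-- An element outside the closure of a subspace can be reduced modulo the subspace to one of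
maximal order, which is not the order of an element of the subspace. -/
theorem exists_reduced_sub {V : Submodule K K⟦X⟧} {g : K⟦X⟧} {B : ℕ} (hB : X ^ B ∣ g)
    (hg : g ∉ adicClosure V) :
    ∃ v ∈ V, ∃ b : ℕ, (g - v).order = b ∧ B ≤ b ∧ ∀ w ∈ V, w.order ≠ b := by
  classical
  obtain ⟨N, hN⟩ : ∃ N : ℕ, ∀ v ∈ V, ¬ X ^ N ∣ g - v := by
    by_contra! hcon
    exact hg hcon
  let P : ℕ → Prop := fun b => ∃ v ∈ V, X ^ b ∣ g - v
  have hP : P B := ⟨0, V.zero_mem, by simpa using hB⟩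
  have hbound : ∀ b, P b → b ≤ N := fun b ⟨v, hv, hb⟩ => by
    by_contra! hlt
    exact hN v hv ((pow_dvd_pow X hlt.le).trans hb)
  obtain ⟨v, hv, hvb⟩ : P (Nat.findGreatest P N) := Nat.findGreatest_spec (hbound B hP) hP
  set b := Nat.findGreatest P N with hb
  have hmax : ∀ w ∈ V, ¬ X ^ (b + 1) ∣ g - w := fun w hw hd => by
    have hP' : P (b + 1) := ⟨w, hw, hd⟩
    have := Nat.le_findGreatest (hbound _ hP') hP'
    omega
  refine ⟨v, hv, b, ?_, Nat.le_findGreatest (hbound B hP) hP, fun w hw hwb => ?_⟩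
  · apply le_antisymm
    · have := hmax v hv
      rw [X_pow_dvd_iff_le_order, not_le] at this
      exact ENat.lt_natCast_add_one_iff.1 (by exact_mod_cast this)
    · exact X_pow_dvd_iff_le_order.1 hvb
  · obtain ⟨c, hc⟩ := exists_X_pow_dvd_sub_smul hvb hwb
    rw [sub_sub] at hc
    exact hmax _ (V.add_mem hv (V.smul_mem c hw)) hc

theorem polySpan_congr {x : K⟦X⟧} {f f' : ℕ → K⟦X⟧} {n : ℕ} (h : ∀ j < n, f j = f' j) :
    polySpan x f n = polySpan x f' n := by
  unfold polySpan
  congr 1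
  ext g
  exact exists_congr fun j => and_congr_right fun hj => by rw [h j hj]

/-- A chain which is not complete can be prolonged: reduce `y * f (n - 1)` modulo the span. -/
theorem IsOrderChain.exists_succ {x y : K⟦X⟧} {m n : ℕ} {a : ℕ → ℕ} {f : ℕ → K⟦X⟧}
    (h : IsOrderChain x y m n a f) (ha : StrictMonoOn a (Set.Iio n)) (hy : X ∣ y)
    (hc : ¬ IsCompleteChain x y n f) :
    ∃ a' f', IsOrderChain x y m (n + 1) a' f' ∧ StrictMonoOn a' (Set.Iio (n + 1)) := by
  have hpos := h.pos
  have hB : X ^ (a (n - 1) + 1) ∣ y * f (n - 1) := by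
    rw [pow_succ']
    exact mul_dvd_mul hy (X_pow_dvd_iff_le_order.2 (h.order_f (n - 1) (by omega)).ge)
  obtain ⟨v, hv, b, hb, hBb, hnot⟩ := exists_reduced_sub hB hc
  have hlt : ∀ i < n, a i < b := fun i hi => by
    have : a i ≤ a (n - 1) := ha.monotoneOn hi (show n - 1 < n by omega) (by omega)
    omega
  have hres : ∀ i < n, a i % m ≠ b % m := fun i hi hmod => by
    obtain ⟨k, hk⟩ : m ∣ b - a i := (Nat.modEq_iff_dvd' (hlt i hi).le).1 hmod
    refine hnot _ (pow_mul_mem_polySpan x f hi k) ?_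
    rw [h.order_pow_mul hi, mul_comm, ← hk, Nat.add_sub_cancel' (hlt i hi).le]
  let a' : ℕ → ℕ := fun i => if i < n then a i else b
  let f' : ℕ → K⟦X⟧ := fun i => if i < n then f i else y * f (n - 1) - v
  have ha' : ∀ i < n, a' i = a i := fun i hi => if_pos hi
  have hf' : ∀ i < n, f' i = f i := fun i hi => if_pos hi
  have han : a' n = b := if_neg (lt_irrefl n)
  have hfn : f' n = y * f (n - 1) - v := if_neg (lt_irrefl n)
  refine ⟨a', f', ⟨h.order_x, h.order_pos, n.succ_pos, ?_, fun i hi => ?_, fun i hi j hj hij => ?_,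
    fun i hi => ?_⟩, fun i hi j hj hij => ?_⟩
  · rw [hf' 0 hpos, h.f_zero]
  · rcases Nat.lt_succ_iff_lt_or_eq.1 hi with hi | rfl
    · rw [ha' i hi, hf' i hi, h.order_f i hi]
    · rw [han, hfn, hb]
  · rcases Nat.lt_succ_iff_lt_or_eq.1 hi with hi | rfl <;>
      rcases Nat.lt_succ_iff_lt_or_eq.1 hj with hj | rfl
    · rw [ha' i hi, ha' j hj] at hij
      exact h.residue i hi j hj hij
    · rw [ha' i hi, han] at hij
      exact absurd hij (hres i hi)
    · rw [ha' j hj, han] at hij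
      exact absurd hij.symm (hres j hj)
    · rfl
  · rw [polySpan_congr fun j hj => hf' j (by omega : j < n), hf' i (by omega)]
    rcases Nat.lt_succ_iff_lt_or_eq.1 hi with hi | rfl
    · rw [hf' _ hi]
      exact h.step i hi
    · rw [hfn]
      simpa using hv
  · have hj : j < n + 1 := hj
    have hi : i < n := by omega
    rw [ha' i hi]
    rcases Nat.lt_succ_iff_lt_or_eq.1 hj with hj | rfl
    · rw [ha' j hj]
      exact ha hi hj hij
    · rw [han]
      exact hlt i hi

/-- Prolonging has to stop at a complete chain, since a chain has at most `m` elements. -/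
theorem exists_isCompleteChain {x y : K⟦X⟧} {m : ℕ} (hx : x.order = m) (hm : 0 < m)
    (hy : X ∣ y) :
    ∃ n a f, IsOrderChain x y m n a f ∧ IsCompleteChain x y n f ∧ StrictMonoOn a (Set.Iio n) := by
  by_contra! hcon
  have key : ∀ n, ∃ a f, IsOrderChain x y m (n + 1) a f ∧ StrictMonoOn a (Set.Iio (n + 1)) := by
    intro n
    induction n with
    | zero =>
      refine ⟨fun _ => 0, fun _ => 1, ⟨hx, hm, Nat.one_pos, rfl, fun i _ => ?_, fun i hi j hj _ => ?_,
        fun i hi => ?_⟩, fun i hi j hj hij => ?_⟩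
      · simp
      · omega
      · omega
      · simp only [Set.mem_Iio] at hi hj
        omega
    | succ n ih =>
      obtain ⟨a, f, h, ha⟩ := ih
      exact h.exists_succ ha hy fun hc => hcon _ a f h hc ha
  obtain ⟨a, f, h, -⟩ := key m
  have := h.length_le
  omega

end PowerSeries

/-! ### Counting elements of unions of arithmetic progressions -/

/-- `⌈z / m⌉` for integers `z` and `m > 0`. -/
def ceilQuot (m : ℕ) (z : ℤ) : ℤ := (z + m - 1) / m

theorem lt_ceilQuot_iff {m : ℕ} (hm : 0 < m) {z k : ℤ} : k < ceilQuot m z ↔ k * m < z := by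
  rw [ceilQuot, ← Int.add_one_le_iff, Int.le_ediv_iff_mul_le (by omega), add_mul]
  omega

theorem ceilQuot_add_mul {m : ℕ} (hm : 0 < m) (z k : ℤ) :
    ceilQuot m (z + k * m) = ceilQuot m z + k := by
  rw [ceilQuot, ceilQuot, ← Int.add_mul_ediv_right _ _ (by omega)]
  congr 1
  ring

theorem ceilQuot_mono {m : ℕ} (hm : 0 < m) : Monotone (ceilQuot m) := fun z w h =>
  Int.ediv_le_ediv (by omega) (by omega)

theorem ceilQuot_eq_iff {m : ℕ} (hm : 0 < m) {z k : ℤ} :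
    ceilQuot m z = k ↔ (k - 1) * m < z ∧ z ≤ k * m := by
  rw [← lt_ceilQuot_iff hm, ← not_lt (b := z), ← lt_ceilQuot_iff hm]
  omega

/-- Adding `r < m` to `z` raises `⌈z / m⌉` exactly when `-z mod m < r`. -/
theorem ceilQuot_add {m : ℕ} (hm : 0 < m) (z : ℤ) {r : ℕ} (hr : r < m) :
    ceilQuot m (z + r) = ceilQuot m z + if (-z) % m < r then 1 else 0 := by
  have h1 := Int.emod_nonneg (-z) (show (m : ℤ) ≠ 0 by omega)
  have h2 := Int.emod_lt_of_pos (-z) (show (0 : ℤ) < m by omega)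
  have h3 := Int.emod_add_mul_ediv (-z) m
  generalize (-z) % (m : ℤ) = u at *
  generalize (-z) / (m : ℤ) = v at *
  have h4 : ceilQuot m z = -v := by
    rw [ceilQuot_eq_iff hm]
    constructor <;> nlinarith
  rw [h4, ceilQuot_eq_iff hm]
  split_ifs <;> constructor <;> nlinarith

/-- If the residues of the `a i` modulo `m` are distinct, the union of the progressions
`a i + m ℕ` is disjoint, so that its elements below `K` may be counted in each of them. -/
theorem countingFunction_eq_sum {Γ : AddSubmonoid ℕ} {m n : ℕ} (hm : 0 < m) {a : ℕ → ℕ}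
    (hres : ∀ i < n, ∀ j < n, a i % m = a j % m → i = j)
    (hΓ : ∀ b, b ∈ Γ ↔ ∃ i < n, ∃ k : ℕ, b = a i + k * m) (K : ℕ) :
    countingFunction Γ K = ∑ i ∈ Finset.range n, (ceilQuot m ((K : ℤ) - a i)).toNat := by
  classical
  have hset : {s : ℕ | s ∈ Γ ∧ s < K} = ((Finset.range n).biUnion fun i =>
      (Finset.range (ceilQuot m ((K : ℤ) - a i)).toNat).image fun k => a i + k * m : Finset ℕ) := by
    ext s
    simp only [Set.mem_ofPred_eq, hΓ, Finset.coe_biUnion, Finset.coe_range, Finset.coe_image,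
      Set.mem_iUnion, Set.mem_image, Set.mem_Iio, Int.lt_toNat, lt_ceilQuot_iff hm]
    constructor
    · rintro ⟨⟨i, hi, k, rfl⟩, hs⟩
      exact ⟨i, hi, k, by push_cast [← Nat.cast_lt (α := ℤ)] at hs; linarith, rfl⟩
    · rintro ⟨i, hi, k, hk, rfl⟩
      exact ⟨⟨i, hi, k, rfl⟩, by zify; linarith⟩
  rw [countingFunction, hset, Set.ncard_coe_finset, Finset.card_biUnion]
  · refine Finset.sum_congr rfl fun i _ => ?_
    rw [Finset.card_image_of_injective _ fun k l hkl => ?_, Finset.card_range]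
    exact Nat.eq_of_mul_eq_mul_right hm (Nat.add_left_cancel hkl)
  · intro i hi j hj hij
    rw [Function.onFun, Finset.disjoint_left]
    intro s hs hs'
    obtain ⟨k, -, rfl⟩ := Finset.mem_image.1 hs
    obtain ⟨l, -, hl⟩ := Finset.mem_image.1 hs'
    refine hij (hres i (by simpa using hi) j (by simpa using hj) ?_)
    rw [← Nat.add_mul_mod_self_right (a i) k m, ← hl, Nat.add_mul_mod_self_right]

theorem mem_closure_pair_succ_iff {m : ℕ} (hm : 0 < m) (b : ℕ) :
    b ∈ AddSubmonoid.closure {m, m + 1} ↔ ∃ i < m, ∃ k : ℕ, b = (i + i * m) + k * m := by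
  rw [AddSubmonoid.mem_closure_pair]
  constructor
  · rintro ⟨α, β, rfl⟩
    refine ⟨β % m, Nat.mod_lt β hm, α + (β / m) * (m + 1), ?_⟩
    simp only [smul_eq_mul]
    conv_lhs => rw [← Nat.mod_add_div β m]
    ring
  · rintro ⟨i, -, k, rfl⟩
    exact ⟨k, i, by simp only [smul_eq_mul]; ring⟩

/-- The inequality behind `H₂(l) ≤ H₁(l - j) + H_{[m]}(j)`. Passing from `l - j` to `l` raises
`⌈(l - j - a i) / m⌉` by `q` or `q + 1`, where `j = q * m + r`, and by `q + 1` for at most `r`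
indices. The sum over `i` of the positive parts of these increments minus `i` is largest when the
`r` indices are the first ones, which gives the counting function of `⟨m, m + 1⟩`. -/
theorem sum_ceilQuot_le {m : ℕ} (hm : 0 < m) {a : ℕ → ℕ}
    (hres : ∀ i < m, ∀ j < m, a i % m = a j % m → i = j) {l j : ℕ} (hj : j ≤ l) :
    ∑ i ∈ Finset.range m, (ceilQuot m ((l : ℤ) - (a i + i * m : ℕ))).toNat ≤
      ∑ i ∈ Finset.range m, (ceilQuot m (((l - j : ℕ) : ℤ) - a i)).toNat +
        ∑ i ∈ Finset.range m, (ceilQuot m ((j : ℤ) - (i + i * m : ℕ))).toNat := by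
  classical
  set q := j / m with hq
  set r := j % m with hr
  have hrm : r < m := Nat.mod_lt j hm
  have hj' : (j : ℤ) = r + q * m := by
    have := Nat.mod_add_div j m
    rw [mul_comm] at this
    exact_mod_cast this.symm
  let u : ℕ → ℤ := fun i => (-((l : ℤ) - j - a i)) % m
  have e1 : ∀ i, ceilQuot m ((l : ℤ) - (a i + i * m : ℕ)) =
      ceilQuot m ((l - j : ℕ) - (a i : ℤ)) + (if u i < r then 1 else 0) + q - i := by
    intro i
    have : (l : ℤ) - (a i + i * m : ℕ) = ((l : ℤ) - j - a i + r) + ((q : ℤ) - i) * m := by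
      rw [hj']
      push_cast
      ring
    rw [this, ceilQuot_add_mul hm, ceilQuot_add hm _ hrm, Nat.cast_sub hj]
    ring
  have e2 : ∀ i < m, ceilQuot m ((j : ℤ) - (i + i * m : ℕ)) =
      (if i < r then 1 else 0) + (q : ℤ) - i := by
    intro i hi
    have : (j : ℤ) - (i + i * m : ℕ) = (-(i : ℤ) + r) + ((q : ℤ) - i) * m := by
      rw [hj']
      push_cast
      ring
    have h0 : ceilQuot m (-(i : ℤ)) = 0 := by
      rw [ceilQuot_eq_iff hm]
      constructor <;> simp
      exact hi
    rw [this, ceilQuot_add_mul hm, ceilQuot_add hm _ hrm, h0, neg_neg,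
      Int.emod_eq_of_lt (by omega) (by omega)]
    simp only [Nat.cast_lt]
    ring
  have hcard : ((Finset.range m).filter fun i => u i < r ∧ i ≤ q).card ≤
      ((Finset.range m).filter fun i => i < r ∧ i ≤ q).card := by
    have hr' : ((Finset.range m).filter fun i => i < r ∧ i ≤ q) =
        Finset.range (min r (q + 1)) := by
      ext i
      simp only [Finset.mem_filter, Finset.mem_range]
      omega
    rw [hr', Finset.card_range, le_min_iff]
    constructor
    · have hu : ∀ i, 0 ≤ u i := fun i => Int.emod_nonneg _ (by omega)
      refine (Finset.card_le_card_of_injOn (t := Finset.range r) (fun i => (u i).toNat)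
        (fun i hi => ?_) fun i hi k hk hik => ?_).trans (Finset.card_range r).le
      · have := (Finset.mem_filter.1 hi).2.1
        have := hu i
        simp only [Finset.coe_range, Set.mem_Iio]
        omega
      · have hi := Finset.mem_range.1 (Finset.mem_filter.1 hi).1
        have hk := Finset.mem_range.1 (Finset.mem_filter.1 hk).1
        have h1 : u i = u k := by
          have := hu i
          have := hu k
          simp only at hik
          omega
        refine hres i hi k hk ?_
        have h2 : (m : ℤ) ∣ -((l : ℤ) - j - a k) - -((l : ℤ) - j - a i) :=
          Int.ModEq.dvd h1
        have h3 : ((a i : ℕ) : ℤ) ≡ (a k : ℕ) [ZMOD m] :=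
          Int.modEq_iff_dvd.2 (by convert h2 using 1; ring)
        exact (Int.natCast_modEq_iff.1 h3)
    · refine (Finset.card_le_card (t := Finset.range (q + 1)) fun i hi => ?_).trans
        (Finset.card_range _).le
      have := (Finset.mem_filter.1 hi).2.2
      simp only [Finset.mem_range]
      omega
  have split : ∀ (p : ℕ → Prop) [DecidablePred p], ∑ i ∈ Finset.range m,
      ((if p i then 1 else 0) + (q : ℤ) - i).toNat = ∑ i ∈ Finset.range m, (q - i) +
        ((Finset.range m).filter fun i => p i ∧ i ≤ q).card := by
    intro p _
    rw [Finset.card_filter, ← Finset.sum_add_distrib]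
    refine Finset.sum_congr rfl fun i _ => ?_
    by_cases hp : p i <;> by_cases hi : i ≤ q <;> simp [hp, hi] <;> omega
  calc _ ≤ ∑ i ∈ Finset.range m, ((ceilQuot m ((l - j : ℕ) - (a i : ℤ))).toNat +
          ((if u i < r then 1 else 0) + (q : ℤ) - i).toNat) := by
        refine Finset.sum_le_sum fun i _ => ?_
        rw [e1]
        omega
    _ ≤ _ := by
        have e3 : ∑ i ∈ Finset.range m, (ceilQuot m ((j : ℤ) - (i + i * m : ℕ))).toNat =
            ∑ i ∈ Finset.range m, ((if i < r then 1 else 0) + (q : ℤ) - i).toNat :=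
          Finset.sum_congr rfl fun i hi => by rw [e2 i (Finset.mem_range.1 hi)]
        rw [Finset.sum_add_distrib, e3, split, split fun i => i < r]
        gcongr

/-- Equality holds for `j = min l (n * m)`, where `n` is the number of progressions
`a i + i * m + m ℕ` which contain an element below `l`. -/
theorem exists_sum_ceilQuot_ge {m : ℕ} (hm : 0 < m) {a : ℕ → ℕ}
    (ha : MonotoneOn a (Set.Iio m)) (l : ℕ) :
    ∃ j ≤ l, ∑ i ∈ Finset.range m, (ceilQuot m (((l - j : ℕ) : ℤ) - a i)).toNat +
        ∑ i ∈ Finset.range m, (ceilQuot m ((j : ℤ) - (i + i * m : ℕ))).toNat ≤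
      ∑ i ∈ Finset.range m, (ceilQuot m ((l : ℤ) - (a i + i * m : ℕ))).toNat := by
  classical
  let p : ℕ → ℤ := fun i => ceilQuot m ((l : ℤ) - a i)
  have hp : ∀ i k, i ≤ k → k < m → p k ≤ p i := fun i k hik hk => by
    have := ha (show i < m by omega) hk hik
    exact ceilQuot_mono hm (by omega)
  have hex : ∃ n, m ≤ n ∨ p n ≤ n := ⟨m, Or.inl le_rfl⟩
  let n := Nat.find hex
  have hn : m ≤ n ∨ p n ≤ n := Nat.find_spec hex
  have hn' : ∀ i < n, ¬ (m ≤ i ∨ p i ≤ i) := fun i hi => Nat.find_min hex hi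
  have hlow : ∀ i < n, (n : ℤ) ≤ p i := fun i hi => by
    have h1 := hn' (n - 1) (by omega)
    have h2 := hp i (n - 1) (by omega) (by omega)
    omega
  have hhigh : ∀ i < m, n ≤ i → p i ≤ n := fun i hi hni => by
    have := hp n i hni hi
    omega
  refine ⟨min l (n * m), min_le_left _ _, ?_⟩
  rw [← Finset.sum_add_distrib]
  refine Finset.sum_le_sum fun i hi => ?_
  rw [Finset.mem_range] at hi
  have e1 : ceilQuot m ((l : ℤ) - (a i + i * m : ℕ)) = p i - i := by
    have : (l : ℤ) - (a i + i * m : ℕ) = ((l : ℤ) - a i) + (-(i : ℤ)) * m := by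
      push_cast
      ring
    rw [this, ceilQuot_add_mul hm]
    rfl
  have h0 : ceilQuot m (-(i : ℤ)) = 0 := by
    rw [ceilQuot_eq_iff hm]
    constructor <;> simp
    exact hi
  have e2 : ceilQuot m (((n * m : ℕ) : ℤ) - (i + i * m : ℕ)) = (n : ℤ) - i := by
    have : ((n * m : ℕ) : ℤ) - (i + i * m : ℕ) = -(i : ℤ) + ((n : ℤ) - i) * m := by
      push_cast
      ring
    rw [this, ceilQuot_add_mul hm, h0, zero_add]
  have e3 : ceilQuot m ((l : ℤ) - (n * m : ℕ) - a i) = p i - n := by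
    have : (l : ℤ) - (n * m : ℕ) - a i = ((l : ℤ) - a i) + (-(n : ℤ)) * m := by
      push_cast
      ring
    rw [this, ceilQuot_add_mul hm]
    rfl
  have h1 := hlow i
  have h2 := hhigh i hi
  rw [e1]
  rcases le_total (n * m) l with hle | hle
  · rw [min_eq_right hle, e2, Nat.cast_sub hle, e3]
    omega
  · -- For `l < n * m` the term `H₁(0)` vanishes, and the other one only decreases.
    have h3 : ceilQuot m (((l - min l (n * m) : ℕ) : ℤ) - a i) ≤ 0 := by
      rw [min_eq_left hle, Nat.sub_self, ← not_lt, lt_ceilQuot_iff hm]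
      simp
    have h4 : ceilQuot m ((min l (n * m) : ℕ) - (i + i * m : ℕ)) ≤ (n : ℤ) - i := by
      rw [← e2]
      exact ceilQuot_mono hm (by omega)
    omega

namespace PowerSeries

/-! ### Expanding in powers of a series -/

/-- If every element of `B` differs from a constant by a multiple `s * h'` with `h' ∈ B`, then
every element of `B` is a power series in `s`, with the successive constants as coefficients. -/
theorem exists_eq_subst_of_forall_mem {K : Type*} [Field K] {s : K⟦X⟧}
    (hs : s.constantCoeff = 0) {B : Set K⟦X⟧}
    (hB : ∀ h ∈ B, ∃ c : K, ∃ h' ∈ B, h = C c + s * h') {h : K⟦X⟧} (hh : h ∈ B) :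
    ∃ φ : K⟦X⟧, h = φ.subst s := by
  have hsub : HasSubst s := HasSubst.of_constantCoeff_zero' hs
  choose! c q hq hcq using hB
  let e : K⟦X⟧ → K⟦X⟧ := fun h => mk fun k => c (q^[k] h)
  have he : ∀ h, e h = X * e (q h) + C (c h) := by
    intro h
    conv_lhs => rw [eq_X_mul_shift_add_const (e h)]
    simp [e]
  have hes : ∀ h, (e h).subst s = s * (e (q h)).subst s + C (c h) := by
    intro h
    conv_lhs => rw [he h, subst_add hsub, subst_mul hsub, subst_X hsub, subst_C]
    rfl
  refine ⟨e h, sub_eq_zero.1 (eq_zero_of_forall_X_pow_dvd fun N => ?_)⟩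
  induction N generalizing h with
  | zero => simp
  | succ N ih =>
    have : h - (e h).subst s = s * (q h - (e (q h)).subst s) := by
      rw [hes h]
      nth_rewrite 1 [hcq h hh]
      ring
    rw [this, pow_succ']
    exact mul_dvd_mul (X_dvd_iff.2 hs) (ih (hq h hh))

theorem dvd_of_order_eq {K : Type*} [Field K] {f g : K⟦X⟧} {b : ℕ} (hg : g.order = b)
    (hf : X ^ b ∣ f) : g ∣ f := by
  have hu := isUnit_divided_by_X_pow_order (ne_zero_of_order_eq hg)
  rw [← X_pow_order_mul_divXPowOrder (f := g), hg, ENat.toNat_natCast]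
  exact hu.mul_right_dvd.2 hf

/-- Let `e > 0` divide all orders of elements of an algebra `A` of power series, and let `e` be a
difference of two such orders. Then there is a series `s` of order `e` such that all elements of
`A` are power series in `s`. -/
theorem exists_forall_eq_subst {K : Type*} [Field K] (A : Subalgebra K K⟦X⟧) {e : ℕ} (he : 0 < e)
    (hdvd : ∀ g ∈ A, ∀ b : ℕ, g.order = b → e ∣ b) {u v : K⟦X⟧} (hu : u ∈ A) (hv : v ∈ A) {b : ℕ}
    (hvb : v.order = b) (hub : u.order = (b + e : ℕ)) :
    ∃ s : K⟦X⟧, s.order = e ∧ ∀ g ∈ A, ∃ φ : K⟦X⟧, g = φ.subst s := by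
  obtain ⟨s, rfl⟩ : v ∣ u := dvd_of_order_eq hvb <| X_pow_dvd_iff_le_order.2 <| by
    rw [hub]; exact_mod_cast Nat.le_add_right b e
  have hse : s.order = e := by
    rw [order_mul, hvb, Nat.cast_add] at hub
    exact (ENat.addLECancellable_natCast b).inj.1 hub
  have hs0 : s.constantCoeff = 0 := by
    rw [← one_le_order_iff_constCoeff_eq_zero, hse]
    exact_mod_cast he
  refine ⟨s, hse, fun g hg => ?_⟩
  -- The power series in the fraction field of `A`; it contains `s`.
  let B : Set K⟦X⟧ := {h | ∃ w ∈ A, w ≠ 0 ∧ w * h ∈ A}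
  refine exists_eq_subst_of_forall_mem hs0 (B := B) ?_ ⟨1, one_mem A, one_ne_zero, by simpa⟩
  rintro h ⟨w, hw, hw0, hwh⟩
  refine ⟨h.constantCoeff, ?_⟩
  have hmem : w * (h - C h.constantCoeff) ∈ A := by
    rw [mul_sub, mul_comm w (C _), ← smul_eq_C_mul]
    exact sub_mem hwh (A.smul_mem hw _)
  suffices hsh : s ∣ h - C h.constantCoeff by
    obtain ⟨h', hh'⟩ := hsh
    refine ⟨h', ⟨w * (v * s), mul_mem hw hu, mul_ne_zero hw0 (ne_zero_of_order_eq hub), ?_⟩,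
      by rw [← hh']; ring⟩
    rw [show w * (v * s) * h' = v * (w * (s * h')) by ring, ← hh']
    exact mul_mem hv hmem
  by_cases h0 : h - C h.constantCoeff = 0
  · rw [h0]
    exact dvd_zero s
  obtain ⟨c, hc⟩ := exists_order_eq h0
  obtain ⟨d, hd⟩ := exists_order_eq hw0
  have hec : e ∣ c := by
    refine (Nat.dvd_add_right (hdvd w hw d hd)).1 (hdvd _ hmem (d + c) ?_)
    rw [order_mul, hd, hc, Nat.cast_add]
  have hcpos : 0 < c := by
    have h1 : (h - C h.constantCoeff).constantCoeff = 0 := by simp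
    rw [← one_le_order_iff_constCoeff_eq_zero, hc] at h1
    exact_mod_cast h1
  exact dvd_of_order_eq hse ((pow_dvd_pow X (Nat.le_of_dvd hcpos hec)).trans
    (X_pow_dvd_iff_le_order.2 hc.ge))

end PowerSeries

/-! ### The semigroup of a branch -/

namespace PlaneBranch

open PowerSeries

/-- Polynomials suffice to compute the semigroup, since truncating `g` at a high degree does not
change the order of `g(x(t), y(t))`. -/
theorem mem_semigroup_iff (C : PlaneBranch) (b : ℕ) :
    b ∈ C.semigroup ↔ ∃ g ∈ Algebra.adjoin ℂ {C.x, C.y}, g.order = b := by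
  have hrange : Set.range ![C.x, C.y] = {C.x, C.y} := by
    simp [Matrix.range_cons, Matrix.range_empty, Set.pair_comm, Set.union_comm]
  have haeval : ∀ p : MvPolynomial (Fin 2) ℂ,
      C.pullback p = MvPolynomial.aeval ![C.x, C.y] p := fun p => by
    rw [pullback, ← MvPowerSeries.substAlgHom_coe C.hasSubst, MvPowerSeries.coe_substAlgHom]
  rw [← hrange, Algebra.adjoin_range_eq_range_aeval]
  constructor
  · rintro ⟨g, hg⟩
    refine ⟨MvPolynomial.aeval ![C.x, C.y] (g.truncTotal (b + 1)), ⟨_, rfl⟩, ?_⟩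
    refine order_eq_of_X_pow_dvd_sub hg b.lt_succ_self ?_
    have hsub : C.pullback g - MvPolynomial.aeval ![C.x, C.y] (g.truncTotal (b + 1)) =
        C.pullback (g - (g.truncTotal (b + 1) : MvPolynomial (Fin 2) ℂ)) := by
      rw [← haeval]
      exact (MvPowerSeries.subst_sub C.hasSubst _ _).symm
    have hord : ((b + 1 : ℕ) : ℕ∞) ≤
        (g - (g.truncTotal (b + 1) : MvPolynomial (Fin 2) ℂ)).order := by
      refine MvPowerSeries.le_order fun d hd => ?_
      rw [map_sub, MvPolynomial.coeff_coe,
        MvPowerSeries.coeff_truncTotal _ (by exact_mod_cast hd), sub_self]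
    have hinf : 1 ≤ ⨅ i, MvPowerSeries.order (![C.x, C.y] i) := by
      refine le_iInf fun i => ?_
      rw [MvPowerSeries.one_le_order_iff_constCoeff_eq_zero]
      fin_cases i
      · exact C.x_zero
      · exact C.y_zero
    refine X_pow_dvd_iff_le_order.2 ?_
    rw [hsub, order_eq_order]
    refine le_trans ?_ (MvPowerSeries.le_order_subst C.hasSubst _)
    calc ((b + 1 : ℕ) : ℕ∞) = 1 * ((b + 1 : ℕ) : ℕ∞) := (one_mul _).symm
      _ ≤ _ := mul_le_mul' hinf hord
  · rintro ⟨_, ⟨p, rfl⟩, hp⟩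
    exact ⟨p, by rw [haeval]; exact hp⟩

theorem not_eq_zero (C : PlaneBranch) : ¬ (C.x = 0 ∧ C.y = 0) := by
  rintro ⟨hx, hy⟩
  have hX : HasSubst (X ^ 2 : ℂ⟦X⟧) := HasSubst.X_pow two_ne_zero
  have h0 : (0 : ℂ⟦X⟧) = (0 : ℂ⟦X⟧).subst (X ^ 2 : ℂ⟦X⟧) := by
    rw [← coe_substAlgHom hX, map_zero]
  exact C.primitive ⟨X ^ 2, 0, 0, by rw [order_X_pow]; rfl, hx.trans h0, hy.trans h0⟩

/-- As the parametrization is primitive, the semigroup has greatest common divisor one. -/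
theorem exists_forall_ge_mem_semigroup (C : PlaneBranch) : ∃ N, ∀ b ≥ N, b ∈ C.semigroup := by
  set e := Nat.setGcd (C.semigroup : Set ℕ) with he
  have hxA : C.x ∈ Algebra.adjoin ℂ {C.x, C.y} := Algebra.subset_adjoin (by simp)
  have hyA : C.y ∈ Algebra.adjoin ℂ {C.x, C.y} := Algebra.subset_adjoin (by simp)
  have hdvd : ∀ g ∈ Algebra.adjoin ℂ {C.x, C.y}, ∀ b : ℕ, g.order = b → e ∣ b := fun g hg b hb =>
    Nat.setGcd_dvd_of_mem ((C.mem_semigroup_iff b).2 ⟨g, hg, hb⟩)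
  obtain ⟨N, hN⟩ := Nat.exists_mem_closure_of_ge (C.semigroup : Set ℕ)
  rw [AddSubmonoid.closure_eq] at hN
  rcases Nat.lt_trichotomy e 1 with h | h | h
  · -- Here all orders vanish, so that `x = y = 0`.
    exfalso
    have key : ∀ g ∈ Algebra.adjoin ℂ {C.x, C.y}, g.constantCoeff = 0 → g = 0 := by
      intro g hg h0
      by_contra hne
      obtain ⟨b, hb⟩ := exists_order_eq hne
      have hb0 := hdvd g hg b hb
      rw [Nat.lt_one_iff.1 h, zero_dvd_iff] at hb0
      rw [← one_le_order_iff_constCoeff_eq_zero, hb, hb0] at h0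
      simp at h0
    exact C.not_eq_zero ⟨key _ hxA C.x_zero, key _ hyA C.y_zero⟩
  · exact ⟨N, fun b hb => hN b hb (by rw [← he, h]; exact one_dvd b)⟩
  · exfalso
    have h1 : e * N ∈ C.semigroup := hN _ (by nlinarith) (Dvd.intro _ rfl)
    have h2 : e * N + e ∈ C.semigroup := hN _ (by nlinarith) (Dvd.intro (N + 1) rfl)
    obtain ⟨v, hv, hvb⟩ := (C.mem_semigroup_iff _).1 h1
    obtain ⟨u, hu, hub⟩ := (C.mem_semigroup_iff _).1 h2
    obtain ⟨s, hs, hall⟩ := exists_forall_eq_subst _ (by omega) hdvd hu hv hvb hub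
    obtain ⟨φ, hφ⟩ := hall _ hxA
    obtain ⟨ψ, hψ⟩ := hall _ hyA
    exact C.primitive ⟨s, φ, ψ, by rw [hs]; exact_mod_cast h, hφ, hψ⟩

/-- A complete order chain of a branch meets every residue class modulo the order of `x`. -/
theorem chain_length_eq (C : PlaneBranch) {m n : ℕ} {a : ℕ → ℕ} {f : ℕ → ℂ⟦X⟧}
    (h : IsOrderChain C.x C.y m n a f) (hc : IsCompleteChain C.x C.y n f) : n = m := by
  classical
  refine le_antisymm h.length_le ?_
  obtain ⟨N, hN⟩ := C.exists_forall_ge_mem_semigroup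
  have hsub : Finset.range m ⊆ (Finset.range n).image fun i => a i % m := by
    intro r hr
    have hmem := hN (r + N * m) (by nlinarith [h.order_pos])
    rw [mem_semigroup_iff, h.exists_order_eq_iff hc] at hmem
    obtain ⟨i, hi, k, hk⟩ := hmem
    refine Finset.mem_image.2 ⟨i, Finset.mem_range.2 hi, ?_⟩
    rw [← Nat.add_mul_mod_self_right (a i) k m, ← hk, Nat.add_mul_mod_self_right,
      Nat.mod_eq_of_lt (Finset.mem_range.1 hr)]
  simpa using (Finset.card_le_card hsub).trans Finset.card_image_le

/-- The branch with the two coordinates exchanged. -/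
def swap (C : PlaneBranch) : PlaneBranch where
  x := C.y
  y := C.x
  x_zero := C.y_zero
  y_zero := C.x_zero
  primitive := fun ⟨s, φ, ψ, hs, hx, hy⟩ => C.primitive ⟨s, ψ, φ, hs, hy, hx⟩

theorem semigroup_swap (C : PlaneBranch) : C.swap.semigroup = C.semigroup := by
  ext b
  rw [mem_semigroup_iff, mem_semigroup_iff, swap, Set.pair_comm]

theorem blowup_x_ne_zero {C₁ C₂ : PlaneBranch} {c : ℂ} (hx : C₂.x = C₁.x)
    (hy : C₂.y = C₁.x * (C₁.y + PowerSeries.C c)) : C₁.x ≠ 0 := by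
  intro h0
  exact C₂.not_eq_zero ⟨hx.trans h0, by rw [hy, h0, zero_mul]⟩

/-- The Apéry sets of the semigroups of a branch and of its blow-up, with respect to the
multiplicity `m` of the branch, are `{a i + i * m}` and `{a i}` for an increasing sequence `a`. -/
theorem exists_apery_of_blowup {C₁ C₂ : PlaneBranch} {c : ℂ} (hx : C₂.x = C₁.x)
    (hy : C₂.y = C₁.x * (C₁.y + PowerSeries.C c)) :
    ∃ a : ℕ → ℕ, ∃ m > 0, m = semigroupMultiplicity C₂.semigroup ∧ StrictMonoOn a (Set.Iio m) ∧
      (∀ i < m, ∀ j < m, a i % m = a j % m → i = j) ∧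
      (∀ b, b ∈ C₁.semigroup ↔ ∃ i < m, ∃ k : ℕ, b = a i + k * m) ∧
      (∀ b, b ∈ C₂.semigroup ↔ ∃ i < m, ∃ k : ℕ, b = (a i + i * m) + k * m) := by
  obtain ⟨m, hm⟩ := exists_order_eq (blowup_x_ne_zero hx hy)
  have hmpos : 0 < m := by
    have := one_le_order_iff_constCoeff_eq_zero.2 C₁.x_zero
    rw [hm] at this
    exact_mod_cast this
  obtain ⟨n, a, f, h, hc, ha⟩ := exists_isCompleteChain hm hmpos (X_dvd_iff.2 C₁.y_zero)
  obtain rfl := C₁.chain_length_eq h hc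
  have h₂ := h.blowup c
  have hc₂ := hc.blowup h.pos c
  have hΓ₂ : ∀ b, b ∈ C₂.semigroup ↔ ∃ i < n, ∃ k : ℕ, b = (a i + i * n) + k * n := fun b => by
    rw [mem_semigroup_iff, hx, hy, h₂.exists_order_eq_iff hc₂]
  have ha0 : a 0 = 0 := by
    have := h.order_f 0 hmpos
    rw [h.f_zero, order_one] at this
    exact_mod_cast this.symm
  refine ⟨a, n, hmpos, ?_, ha, h.residue, fun b => ?_, hΓ₂⟩
  · have hn : n ∈ C₂.semigroup := (hΓ₂ n).2 ⟨0, hmpos, 1, by simp [ha0]⟩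
    refine (IsLeast.csInf_eq (s := {s : ℕ | s ∈ C₂.semigroup ∧ 0 < s}) ⟨⟨hn, hmpos⟩, ?_⟩).symm
    rintro b ⟨hb, hbpos⟩
    obtain ⟨i, -, k, rfl⟩ := (hΓ₂ b).1 hb
    rcases Nat.eq_zero_or_pos i with rfl | hi
    · rcases Nat.eq_zero_or_pos k with rfl | hk
      · simp [ha0] at hbpos
      · nlinarith
    · nlinarith
  · rw [mem_semigroup_iff, h.exists_order_eq_iff hc]

end PlaneBranch

/-! ### The infimal convolution formula -/

theorem isLeast_countingFunction_of_apery {Γ₁ Γ₂ : AddSubmonoid ℕ} {m : ℕ} (hm : 0 < m)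
    {a : ℕ → ℕ} (ha : MonotoneOn a (Set.Iio m))
    (hres : ∀ i < m, ∀ j < m, a i % m = a j % m → i = j)
    (h₁ : ∀ b, b ∈ Γ₁ ↔ ∃ i < m, ∃ k : ℕ, b = a i + k * m)
    (h₂ : ∀ b, b ∈ Γ₂ ↔ ∃ i < m, ∃ k : ℕ, b = (a i + i * m) + k * m) (l : ℕ) :
    IsLeast
      {n : ℕ | ∃ j : ℕ, j ≤ l ∧
        n = countingFunction Γ₁ (l - j) +
          countingFunction (AddSubmonoid.closure {m, m + 1}) j}
      (countingFunction Γ₂ l) := by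
  have e₁ := countingFunction_eq_sum hm hres h₁
  have e₂ := countingFunction_eq_sum (a := fun i => a i + i * m) hm (by simpa using hres) h₂
  have e₃ := countingFunction_eq_sum (a := fun i => i + i * m) hm
    (fun i hi j hj hij => by simpa [Nat.mod_eq_of_lt, hi, hj] using hij)
    (mem_closure_pair_succ_iff hm)
  have hle : ∀ j ≤ l, countingFunction Γ₂ l ≤ countingFunction Γ₁ (l - j) +
      countingFunction (AddSubmonoid.closure {m, m + 1}) j := fun j hj => by
    rw [e₁, e₂, e₃]
    exact sum_ceilQuot_le hm hres hj
  constructor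
  · obtain ⟨j, hj, hge⟩ := exists_sum_ceilQuot_ge hm ha l
    refine ⟨j, hj, le_antisymm (hle j hj) ?_⟩
    rw [e₁, e₂, e₃]
    exact hge
  · rintro _ ⟨j, hj, rfl⟩
    exact hle j hj

theorem mainTheorem2 (C₁ C₂ : PlaneBranch) (h : C₁.IsBlowupOf C₂) (m : ℕ)
    (hm : m = semigroupMultiplicity C₂.semigroup) (l : ℕ) :
    IsLeast
      {n : ℕ | ∃ j : ℕ, j ≤ l ∧
        n = countingFunction C₁.semigroup (l - j) +
          countingFunction (AddSubmonoid.closure {m, m + 1}) j}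
      (countingFunction C₂.semigroup l) := by
  rcases h with ⟨c, hx, hy⟩ | ⟨c, hx, hy⟩
  · obtain ⟨a, m', hpos, hm', ha, hres, h₁, h₂⟩ := PlaneBranch.exists_apery_of_blowup hx hy
    obtain rfl := hm.trans hm'.symm
    exact isLeast_countingFunction_of_apery hpos ha.monotoneOn hres h₁ h₂ l
  · rw [← C₁.semigroup_swap, ← C₂.semigroup_swap]
    rw [← C₂.semigroup_swap] at hm
    obtain ⟨a, m', hpos, hm', ha, hres, h₁, h₂⟩ := PlaneBranch.exists_apery_of_blowup
      (C₁ := C₁.swap) (C₂ := C₂.swap) (c := c) hy (hx.trans (mul_comm _ _))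
    obtain rfl := hm.trans hm'.symm
    exact isLeast_countingFunction_of_apery hpos ha.monotoneOn hres h₁ h₂ l
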